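/- Let $p$ be a prime and let $\lambda=(\lambda_1,\lambda_2)\in\{(1,0),(0,1),(1,1),\dots,(p-1,1)\}$. The Jonah–Konvisser group $G_\lambda^{(p)}$ is the group presented by the generators $a_1,a_2,b_1,b_2$, the relations $[[x,y],z]=1$ for all words $x,y,z$ in the generators and their inverses (nilpotency class at most $2$), and the additional relations $$a_1^p=[a_1,b_1],\quad a_2^p=[a_1,b_1^{\lambda_1}b_2^{\lambda_2}],\quad b_1^p=[a_2,b_1b_2],\quad b_2^p=[a_2,b_2],\quad [a_1,a_2]=[b_1,b_2]=1.$$ Theorem. Suppose that $p\ge 3$ and $\lambda\ne(1,0)$, or that $p=2$ and $\lambda=(0,1)$. Then $G_\lambda^{(p)}$ has order $p^8$, every endomorphism of $G_\lambda^{(p)}$ that is not an automorphism has its image contained in the centre of $G_\lambda^{(p)}$, and the monoid of endomorphisms of $G_\lambda^{(p)}$ under composition is commutative. In particular, for every prime $p$ there exists a nonabelian finite $p$-group whose endomorphism monoid is commutative. -/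

import Mathlib

namespace JonahKonvisser

open scoped commutatorElement

/-- The four generator symbols. -/
inductive Gen : Type
  | a₁ | a₂ | b₁ | b₂

/-- The free generator attached to a symbol. -/
def gen (s : Gen) : FreeGroup Gen := FreeGroup.of s

/-- The parameter set `{(1,0), (0,1), (1,1), …, (p-1,1)}`. -/
def params (p : ℕ) : Set (ℕ × ℕ) :=
  {(1, 0)} ∪ {l | l.1 < p ∧ l.2 = 1}

/-- The relators that force nilpotency class at most two: all commutators `[[x,y],z]`. -/
def classTwoRels : Set (FreeGroup Gen) :=
  {r | ∃ x y z : FreeGroup Gen, r = ⁅⁅x, y⁆, z⁆}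

/-- The additional relators, a relation `u = v` being written as the relator `u * v⁻¹`.
Here `⁅x, y⁆ = x * y * x⁻¹ * y⁻¹`; in a group of class at most two this equals
`x⁻¹ * y⁻¹ * x * y`, so the choice of convention does not matter. -/
def powerRels (p : ℕ) (l : ℕ × ℕ) : Set (FreeGroup Gen) :=
  { gen .a₁ ^ p * ⁅gen .a₁, gen .b₁⁆⁻¹,
    gen .a₂ ^ p * ⁅gen .a₁, gen .b₁ ^ l.1 * gen .b₂ ^ l.2⁆⁻¹,
    gen .b₁ ^ p * ⁅gen .a₂, gen .b₁ * gen .b₂⁆⁻¹,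
    gen .b₂ ^ p * ⁅gen .a₂, gen .b₂⁆⁻¹,
    ⁅gen .a₁, gen .a₂⁆,
    ⁅gen .b₁, gen .b₂⁆ }

/-- The Jonah–Konvisser group `G_l^{(p)}`: the group of class two presented by the generators
`a₁, a₂, b₁, b₂` and the additional relations. -/
abbrev JKGroup (p : ℕ) (l : ℕ × ℕ) : Type :=
  PresentedGroup (classTwoRels ∪ powerRels p l)

/-- A group is end-commutative if its endomorphism monoid is commutative. -/
def EndCommutative (G : Type*) [Group G] : Prop :=
  ∀ φ ψ : Monoid.End G, φ * ψ = ψ * φ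

end JonahKonvisser

/-! Write `λ = (t, 1)`. Modulo the kernel `N` of reduction mod `p`, the group is `F_p^4`, and `N`
lies in both the centre and the derived subgroup. In coordinates on `N` given by the `p`-th powers
of the generators, the commutator is the form `bracket t`. For odd `p` the power map is the identity
in these coordinates; for `p = 2` it has a quadratic correction. An endomorphism thus yields four
vectors satisfying the defining equations, and rigidity (`rigid_of_linear`, `rigidTwo`) says that
these are all zero or the standard basis.

So every endomorphism maps into `N`, or is the identity modulo `N`. The first kind has central image
and kills `N`; the second fixes `N` pointwise, hence is injective. Commutativity follows formally
(`endCommutative_of_dichotomy`).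

These coordinates are legitimate because the presented group is isomorphic to an explicit group on
`(Z/p²)^4`: the model satisfies the relations, and collection brings every element to the form `a₁^i
a₂^j b₁^k b₂^l` with exponents mod `p²`. This also gives the order `p^8`. -/

namespace JonahKonvisser

open scoped commutatorElement

/-! ### Groups all of whose endomorphisms are trivial or the identity modulo a subgroup -/

section General

variable {G : Type*} [Group G]

theorem hom_eq_one_of_range_le_center {φ : G →* G} (h : ∀ x, φ x ∈ Subgroup.center G) {x : G}
    (hx : x ∈ commutator G) : φ x = 1 := by
  have : commutator G ≤ φ.ker := by
    rw [commutator_def, Subgroup.commutator_le]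
    intro a _ b _
    rw [MonoidHom.mem_ker, map_commutatorElement, commutatorElement_eq_one_iff_mul_comm]
    exact (Subgroup.mem_center_iff.1 (h a) (φ b)).symm
  exact this hx

/-- A commutator does not change when its entries are multiplied by central elements. -/
theorem hom_fixes_commutator {φ : G →* G} (h : ∀ x, φ x * x⁻¹ ∈ Subgroup.center G) {x : G}
    (hx : x ∈ commutator G) : φ x = x := by
  have : commutator G ≤ φ.eqLocus (MonoidHom.id G) := by
    rw [commutator_def, Subgroup.commutator_le]
    intro a _ b _
    change φ ⁅a, b⁆ = ⁅a, b⁆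
    obtain ⟨c, hc, ha⟩ : ∃ c ∈ Subgroup.center G, φ a = c * a := ⟨_, h a, by group⟩
    obtain ⟨d, hd, hb⟩ : ∃ d ∈ Subgroup.center G, φ b = d * b := ⟨_, h b, by group⟩
    rw [Subgroup.mem_center_iff] at hc hd
    rw [map_commutatorElement, ha, hb, commutatorElement_def, commutatorElement_def]
    calc c * a * (d * b) * (c * a)⁻¹ * (d * b)⁻¹
        = c * (a * d * b) * a⁻¹ * c⁻¹ * b⁻¹ * d⁻¹ := by group
      _ = (a * d * b) * a⁻¹ * (c * c⁻¹) * b⁻¹ * d⁻¹ := by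
          rw [← hc (a * d * b), mul_assoc _ c a⁻¹, ← hc a⁻¹]; group
      _ = (d * a) * b * a⁻¹ * b⁻¹ * d⁻¹ := by rw [hd a]; group
      _ = d * (a * b * a⁻¹ * b⁻¹) * d⁻¹ := by group
      _ = a * b * a⁻¹ * b⁻¹ := by rw [← hd]; group
  exact this hx

/-- If every endomorphism is trivial or the identity modulo a subgroup of `Z(G) ∩ G'`, then the
endomorphism monoid is commutative. -/
theorem endCommutative_of_dichotomy (N : Subgroup G) (hc : N ≤ Subgroup.center G)
    (hN : N ≤ commutator G)
    (h : ∀ φ : G →* G, (∀ x, φ x ∈ N) ∨ ∀ x, φ x * x⁻¹ ∈ N) : EndCommutative G := by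
  have key : ∀ φ ψ : G →* G, (∀ x, φ x ∈ N) → ∀ x, φ (ψ x) = ψ (φ x) := by
    intro φ ψ hφ x
    rcases h ψ with hψ | hψ
    · rw [hom_eq_one_of_range_le_center (fun y => hc (hφ y)) (hN (hψ x)),
        hom_eq_one_of_range_le_center (fun y => hc (hψ y)) (hN (hφ x))]
    · rw [hom_fixes_commutator (fun y => hc (hψ y)) (hN (hφ x))]
      have := hom_eq_one_of_range_le_center (fun y => hc (hφ y)) (hN (hψ x))
      rwa [map_mul, map_inv, mul_inv_eq_one] at this
  suffices H : ∀ (φ ψ : G →* G) (x : G), φ (ψ x) = ψ (φ x) from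
    fun φ ψ => MonoidHom.ext fun x => H φ ψ x
  intro φ ψ x
  rcases h φ with hφ | hφ
  · exact key φ ψ hφ x
  · rcases h ψ with hψ | hψ
    · exact (key ψ φ hψ x).symm
    -- Each map fixes the central displacement of the other, so both composites multiply `x` by the
    -- two displacements, in either order.
    · have h1 := hom_fixes_commutator (fun y => hc (hφ y)) (hN (hψ x))
      have h2 := hom_fixes_commutator (fun y => hc (hψ y)) (hN (hφ x))
      rw [map_mul, map_inv] at h1 h2
      have h3 : φ (ψ x) = ψ x * x⁻¹ * φ x := by rw [← h1]; group
      have h4 : ψ (φ x) = φ x * x⁻¹ * ψ x := by rw [← h2]; group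
      have h5 := Subgroup.mem_center_iff.1 (hc (hψ x)) (φ x * x⁻¹)
      rw [h3, h4]
      calc ψ x * x⁻¹ * φ x = (ψ x * x⁻¹ * (φ x * x⁻¹)) * x := by group
        _ = (φ x * x⁻¹ * (ψ x * x⁻¹)) * x := by rw [h5]
        _ = φ x * x⁻¹ * ψ x := by group

/-- A kernel element lies in `N`, hence in the derived subgroup, which `φ` fixes pointwise. -/
theorem injective_of_identity_mod {N : Subgroup G} (hc : N ≤ Subgroup.center G)
    (hN : N ≤ commutator G) {φ : G →* G} (h : ∀ x, φ x * x⁻¹ ∈ N) :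
    Function.Injective φ := by
  rw [injective_iff_map_eq_one]
  intro x hx
  have h1 := h x
  rw [hx, one_mul, inv_mem_iff] at h1
  rw [← hom_fixes_commutator (fun y => hc (h y)) (hN h1), hx]

end General

/-! ### Commutator calculus in class two -/

section ClassTwo

variable {G : Type*} [Group G]

theorem commutator_commute (h : ∀ x y z : G, ⁅⁅x, y⁆, z⁆ = 1) (x y z : G) :
    ⁅x, y⁆ * z = z * ⁅x, y⁆ :=
  commutatorElement_eq_one_iff_mul_comm.1 (h x y z)

theorem commutator_mul_left (h : ∀ x y z : G, ⁅⁅x, y⁆, z⁆ = 1) (x x' y : G) :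
    ⁅x * x', y⁆ = ⁅x, y⁆ * ⁅x', y⁆ := by
  calc ⁅x * x', y⁆ = x * ⁅x', y⁆ * y * x⁻¹ * y⁻¹ := by simp only [commutatorElement_def]; group
    _ = ⁅x', y⁆ * ⁅x, y⁆ := by
      rw [← commutator_commute h x' y x]; simp only [commutatorElement_def]; group
    _ = ⁅x, y⁆ * ⁅x', y⁆ := commutator_commute h _ _ _

theorem commutator_zpow_left (h : ∀ x y z : G, ⁅⁅x, y⁆, z⁆ = 1) (x y : G) (n : ℤ) :
    ⁅x ^ n, y⁆ = ⁅x, y⁆ ^ n :=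
  map_zpow (MonoidHom.mk' (fun x => ⁅x, y⁆) fun a b => commutator_mul_left h a b y) x n

theorem commutator_zpow_right (h : ∀ x y z : G, ⁅⁅x, y⁆, z⁆ = 1) (x y : G) (n : ℤ) :
    ⁅x, y ^ n⁆ = ⁅x, y⁆ ^ n := by
  rw [← inv_inj, commutatorElement_inv, commutator_zpow_left h, ← inv_zpow, commutatorElement_inv]

theorem commutator_mul_right (h : ∀ x y z : G, ⁅⁅x, y⁆, z⁆ = 1) (x y y' : G) :
    ⁅x, y * y'⁆ = ⁅x, y⁆ * ⁅x, y'⁆ := by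
  rw [← inv_inj, commutatorElement_inv, commutator_mul_left h, mul_inv_rev, commutatorElement_inv,
    commutatorElement_inv, commutator_commute h]

theorem zpow_mul_zpow_eq (h : ∀ x y z : G, ⁅⁅x, y⁆, z⁆ = 1) (a b : G) (i n : ℤ) :
    b ^ n * a ^ i = ⁅a, b⁆ ^ (-(i * n)) * (a ^ i * b ^ n) := by
  rw [zpow_neg, zpow_mul, ← commutator_zpow_left h, ← commutator_zpow_right h,
    commutatorElement_def]
  group

/-- `v ^ (p ^ 2) = ⁅u, z⁆ ^ p = ⁅u ^ p, z⁆`, and `u ^ p` is a commutator, hence central. Here `u`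
will be `a₁` or `a₂`. -/
theorem pow_sq_eq_one (h : ∀ x y z : G, ⁅⁅x, y⁆, z⁆ = 1) {p : ℕ} {u v x y z : G}
    (hu : u ^ p = ⁅x, y⁆) (hv : v ^ p = ⁅u, z⁆) : v ^ (p ^ 2) = 1 := by
  have := commutator_zpow_left h u z p
  rw [zpow_natCast, zpow_natCast, hu, h] at this
  rw [sq, pow_mul, hv, ← this]

end ClassTwo

/-! ### The concrete model -/

/-- Coordinates of the model of `G_{(t,1)}^{(p)}`; `⟨i, j, k, l⟩` stands for
`a₁ ^ i * a₂ ^ j * b₁ ^ k * b₂ ^ l`. -/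
@[ext]
structure Model (p t : ℕ) : Type where
  x₁ : ZMod (p ^ 2)
  x₂ : ZMod (p ^ 2)
  y₁ : ZMod (p ^ 2)
  y₂ : ZMod (p ^ 2)

namespace Model

variable {p t : ℕ}

/-- The terms with factor `p` come from collection: moving the `b`-part of `v` past the `a`-part of
`w` creates commutators `⁅aᵢ, bⱼ⁆`, which the relations turn into `p`-th powers of generators. -/
instance : Mul (Model p t) where
  mul v w :=
    { x₁ := v.x₁ + w.x₁ - p * (w.x₁ * v.y₁ - t * w.x₁ * v.y₂)
      x₂ := v.x₂ + w.x₂ - p * (w.x₁ * v.y₂)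
      y₁ := v.y₁ + w.y₁ - p * (w.x₂ * v.y₁)
      y₂ := v.y₂ + w.y₂ - p * (w.x₂ * v.y₂ - w.x₂ * v.y₁) }

instance : One (Model p t) where
  one := ⟨0, 0, 0, 0⟩

instance : Inv (Model p t) where
  inv v :=
    { x₁ := -v.x₁ - p * (v.x₁ * v.y₁ - t * v.x₁ * v.y₂)
      x₂ := -v.x₂ - p * (v.x₁ * v.y₂)
      y₁ := -v.y₁ - p * (v.x₂ * v.y₁)
      y₂ := -v.y₂ - p * (v.x₂ * v.y₂ - v.x₂ * v.y₁) }

theorem mul_x₁ (v w : Model p t) :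
    (v * w).x₁ = v.x₁ + w.x₁ - p * (w.x₁ * v.y₁ - t * w.x₁ * v.y₂) := rfl
theorem mul_x₂ (v w : Model p t) : (v * w).x₂ = v.x₂ + w.x₂ - p * (w.x₁ * v.y₂) := rfl
theorem mul_y₁ (v w : Model p t) : (v * w).y₁ = v.y₁ + w.y₁ - p * (w.x₂ * v.y₁) := rfl
theorem mul_y₂ (v w : Model p t) :
    (v * w).y₂ = v.y₂ + w.y₂ - p * (w.x₂ * v.y₂ - w.x₂ * v.y₁) := rfl
theorem one_x₁ : (1 : Model p t).x₁ = 0 := rfl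
theorem one_x₂ : (1 : Model p t).x₂ = 0 := rfl
theorem one_y₁ : (1 : Model p t).y₁ = 0 := rfl
theorem one_y₂ : (1 : Model p t).y₂ = 0 := rfl
theorem inv_x₁ (v : Model p t) :
    v⁻¹.x₁ = -v.x₁ - p * (v.x₁ * v.y₁ - t * v.x₁ * v.y₂) := rfl
theorem inv_x₂ (v : Model p t) : v⁻¹.x₂ = -v.x₂ - p * (v.x₁ * v.y₂) := rfl
theorem inv_y₁ (v : Model p t) : v⁻¹.y₁ = -v.y₁ - p * (v.x₂ * v.y₁) := rfl
theorem inv_y₂ (v : Model p t) :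
    v⁻¹.y₂ = -v.y₂ - p * (v.x₂ * v.y₂ - v.x₂ * v.y₁) := rfl

theorem natCast_sq_eq_zero (p : ℕ) : (p : ZMod (p ^ 2)) ^ 2 = 0 := by
  rw [← Nat.cast_pow, ZMod.natCast_self]

instance : Group (Model p t) :=
  Group.ofLeftAxioms
    (by
      intro u v w
      have := natCast_sq_eq_zero p
      ext <;> simp only [mul_x₁, mul_x₂, mul_y₁, mul_y₂] <;> grind)
    (by
      intro v
      ext <;> simp only [mul_x₁, mul_x₂, mul_y₁, mul_y₂, one_x₁, one_x₂, one_y₁, one_y₂] <;> ring)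
    (by
      intro v
      have := natCast_sq_eq_zero p
      ext <;> simp only [mul_x₁, mul_x₂, mul_y₁, mul_y₂, one_x₁, one_x₂, one_y₁, one_y₂, inv_x₁,
        inv_x₂, inv_y₁, inv_y₂] <;> grind)

theorem commutator_eq (v w : Model p t) :
    ⁅v, w⁆ =
      { x₁ := p * ((v.x₁ * w.y₁ - w.x₁ * v.y₁) - t * (v.x₁ * w.y₂ - w.x₁ * v.y₂))
        x₂ := p * (v.x₁ * w.y₂ - w.x₁ * v.y₂)
        y₁ := p * (v.x₂ * w.y₁ - w.x₂ * v.y₁)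
        y₂ := p * ((v.x₂ * w.y₂ - w.x₂ * v.y₂) - (v.x₂ * w.y₁ - w.x₂ * v.y₁)) } := by
  have := natCast_sq_eq_zero p
  rw [commutatorElement_def, mul_inv_eq_iff_eq_mul, mul_inv_eq_iff_eq_mul]
  ext <;> simp only [mul_x₁, mul_x₂, mul_y₁, mul_y₂] <;> grind

theorem classTwo (u v w : Model p t) : ⁅⁅u, v⁆, w⁆ = 1 := by
  have := natCast_sq_eq_zero p
  rw [commutator_eq, commutator_eq]
  ext <;> simp only [one_x₁, one_x₂, one_y₁, one_y₂] <;> grind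

/-- Each of the `n.choose 2` pairs of factors contributes one collection term. -/
theorem pow_eq (v : Model p t) (n : ℕ) :
    v ^ n =
      { x₁ := n * v.x₁ - p * (n.choose 2 * (v.x₁ * v.y₁ - t * v.x₁ * v.y₂))
        x₂ := n * v.x₂ - p * (n.choose 2 * (v.x₁ * v.y₂))
        y₁ := n * v.y₁ - p * (n.choose 2 * (v.x₂ * v.y₁))
        y₂ := n * v.y₂ - p * (n.choose 2 * (v.x₂ * v.y₂ - v.x₂ * v.y₁)) } := by
  induction n with
  | zero => ext <;> simp [one_x₁, one_x₂, one_y₁, one_y₂]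
  | succ n ih =>
    have := natCast_sq_eq_zero p
    have h2 : (n + 1).choose 2 = n + n.choose 2 := by
      rw [Nat.choose_succ_succ' n 1, Nat.choose_one_right]
    rw [pow_succ, ih, h2]
    ext <;> simp only [mul_x₁, mul_x₂, mul_y₁, mul_y₂, Nat.cast_add, Nat.cast_one] <;> grind

end Model
/-! ### The linear algebra over the residue field -/

section Core

/-- The commutator form on `F ^ 4`, in the coordinates given by the power map. -/
def bracket {F : Type*} [CommRing F] (t : F) (v w : Fin 4 → F) : Fin 4 → F :=
  ![(v 0 * w 2 - w 0 * v 2) - t * (v 0 * w 3 - w 0 * v 3),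
    v 0 * w 3 - w 0 * v 3,
    v 1 * w 2 - w 1 * v 2,
    (v 1 * w 3 - w 1 * v 3) - (v 1 * w 2 - w 1 * v 2)]

theorem vec4_ext {F : Type*} {v w : Fin 4 → F} (h0 : v 0 = w 0) (h1 : v 1 = w 1) (h2 : v 2 = w 2)
    (h3 : v 3 = w 3) : v = w := by
  funext i
  fin_cases i <;> assumption

variable {F : Type*} [Field F]

theorem bracket_zero (t : F) (v w : Fin 4 → F) : bracket t v w 0 =
    (v 0 * w 2 - w 0 * v 2) - t * (v 0 * w 3 - w 0 * v 3) := rfl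
theorem bracket_one (t : F) (v w : Fin 4 → F) :
    bracket t v w 1 = v 0 * w 3 - w 0 * v 3 := rfl
theorem bracket_two (t : F) (v w : Fin 4 → F) :
    bracket t v w 2 = v 1 * w 2 - w 1 * v 2 := rfl
theorem bracket_three (t : F) (v w : Fin 4 → F) : bracket t v w 3 =
    (v 1 * w 3 - w 1 * v 3) - (v 1 * w 2 - w 1 * v 2) := rfl

theorem bracket_self (t : F) (v : Fin 4 → F) : bracket t v v = 0 := by
  apply vec4_ext <;> simp [bracket_zero, bracket_one, bracket_two, bracket_three]

theorem bracket_smul_right (t s : F) (v w : Fin 4 → F) :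
    bracket t v (s • w) = s • bracket t v w := by
  apply vec4_ext <;> simp [bracket_zero, bracket_one, bracket_two, bracket_three] <;> ring

theorem bracket_smul_left (t s : F) (v w : Fin 4 → F) :
    bracket t (s • v) w = s • bracket t v w := by
  apply vec4_ext <;> simp [bracket_zero, bracket_one, bracket_two, bracket_three] <;> ring

theorem bracket_add_right (t : F) (v w w' : Fin 4 → F) :
    bracket t v (w + w') = bracket t v w + bracket t v w' := by
  apply vec4_ext <;> simp [bracket_zero, bracket_one, bracket_two, bracket_three] <;> ring

/-- Two vectors with vanishing bracket are proportional, or both lie in one of the two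
distinguished planes. -/
theorem bracket_eq_zero_cases {t : F} {v w : Fin 4 → F} (h : bracket t v w = 0) :
    (∃ s : F, w = s • v) ∨ (∃ s : F, v = s • w) ∨
      ((v 2 = 0 ∧ v 3 = 0) ∧ w 2 = 0 ∧ w 3 = 0) ∨ ((v 0 = 0 ∧ v 1 = 0) ∧ w 0 = 0 ∧ w 1 = 0) := by
  have h0 := congrFun h 0
  have h1 := congrFun h 1
  have h2 := congrFun h 2
  have h3 := congrFun h 3
  simp only [bracket_zero, bracket_one, bracket_two, bracket_three, Pi.zero_apply] at h0 h1 h2 h3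
  -- With `v = (x, y)` and `w = (x', y')`, the hypothesis now reads `x ⊗ y' = x' ⊗ y`. If `x` and
  -- `y` are nonzero, this forces `w` to be a multiple of `v`.
  have h0' : v 0 * w 2 - w 0 * v 2 = 0 := by linear_combination h0 + t * h1
  have h3' : v 1 * w 3 - w 1 * v 3 = 0 := by linear_combination h3 + h2
  by_cases hv : v = 0
  · exact Or.inr (Or.inl ⟨0, by simp [hv]⟩)
  by_cases hx : v 0 = 0 ∧ v 1 = 0
  · by_cases hw : w 0 = 0 ∧ w 1 = 0
    · exact Or.inr (Or.inr (Or.inr ⟨hx, hw⟩))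
    · exfalso
      apply hv
      obtain ⟨hx0, hx1⟩ := hx
      have : v 2 = 0 ∧ v 3 = 0 := by grind
      exact vec4_ext hx0 hx1 this.1 this.2
  by_cases hy : v 2 = 0 ∧ v 3 = 0
  · refine Or.inr (Or.inr (Or.inl ⟨hy, ?_⟩))
    obtain ⟨hy2, hy3⟩ := hy
    grind
  left
  obtain ⟨s, hs0, hs1, hs2, hs3⟩ :
      ∃ s : F, w 0 = s * v 0 ∧ w 1 = s * v 1 ∧ w 2 = s * v 2 ∧ w 3 = s * v 3 := by
    have hy' : v 2 ≠ 0 ∨ v 3 ≠ 0 := by tauto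
    by_cases hx0 : v 0 = 0
    · have hx1 : v 1 ≠ 0 := by tauto
      refine ⟨w 1 / v 1, ?_, ?_, ?_, ?_⟩
      · field_simp; grind
      · field_simp
      · field_simp; grind
      · field_simp; grind
    · refine ⟨w 0 / v 0, ?_, ?_, ?_, ?_⟩
      · field_simp
      · field_simp; grind
      · field_simp; grind
      · field_simp; grind
  exact ⟨s, vec4_ext hs0 hs1 hs2 hs3⟩

variable {t : F} {u₁ u₂ w₁ w₂ : Fin 4 → F}

/-- If `u₂` is a multiple of `u₁`, the equations make `w₂`, then `w₁`, multiples of `u₁`. As the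
bracket is alternating, `e₁` gives `u₁ = 0`. -/
theorem eq_zero_of_smul (e₁ : u₁ = bracket t u₁ w₁) (e₂ : u₂ - t • u₁ = bracket t u₁ w₂)
    (e₃ : w₁ - w₂ = bracket t u₂ w₁) (e₄ : w₂ = bracket t u₂ w₂) (h : ∃ s : F, u₂ = s • u₁) :
    u₁ = 0 ∧ u₂ = 0 ∧ w₁ = 0 ∧ w₂ = 0 := by
  obtain ⟨s, h⟩ := h
  rw [h, bracket_smul_left, ← e₁] at e₃
  replace e₄ : w₂ = s • (u₂ - t • u₁) := by
    rw [e₂, ← bracket_smul_left, ← h]; exact e₄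
  have hw₁ : w₁ = (s + s * (s - t)) • u₁ := by
    rw [sub_eq_iff_eq_add.1 e₃, e₄, h]; module
  have hu : u₁ = 0 := by
    rw [e₁, hw₁, bracket_smul_right, bracket_self, smul_zero]
  have hu₂ : u₂ = 0 := by rw [h, hu, smul_zero]
  have hw₂ : w₂ = 0 := by
    rw [e₄, hu₂, hu, smul_zero, sub_zero, smul_zero]
  exact ⟨hu, hu₂, by rw [hw₁, hu, smul_zero], hw₂⟩

theorem eq_zero_of_smul_right (e₁ : u₁ = bracket t u₁ w₁) (e₂ : u₂ - t • u₁ = bracket t u₁ w₂)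
    (e₃ : w₁ - w₂ = bracket t u₂ w₁) (e₄ : w₂ = bracket t u₂ w₂) (h : ∃ s : F, w₂ = s • w₁) :
    u₁ = 0 ∧ u₂ = 0 ∧ w₁ = 0 ∧ w₂ = 0 := by
  refine eq_zero_of_smul e₁ e₂ e₃ e₄ ?_
  obtain ⟨s, rfl⟩ := h
  rw [bracket_smul_right, ← e₁] at e₂
  exact ⟨s + t, by rw [sub_eq_iff_eq_add.1 e₂]; module⟩

theorem exists_smul_symm {v w : Fin 4 → F} (h : ∃ s : F, v = s • w) :
    v = 0 ∨ ∃ s : F, w = s • v := by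
  obtain ⟨s, rfl⟩ := h
  rcases eq_or_ne s 0 with rfl | hs
  · simp
  · exact Or.inr ⟨s⁻¹, by rw [smul_smul, inv_mul_cancel₀ hs, one_smul]⟩

/-- Rigidity when the power map is linear: a solution of the defining equations
is zero or the standard basis. -/
theorem rigid_of_linear (e₁ : u₁ = bracket t u₁ w₁) (e₂ : u₂ = bracket t u₁ (t • w₁ + w₂))
    (e₃ : w₁ = bracket t u₂ (w₁ + w₂)) (e₄ : w₂ = bracket t u₂ w₂)
    (e₅ : bracket t u₁ u₂ = 0) (e₆ : bracket t w₁ w₂ = 0) :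
    (u₁ = 0 ∧ u₂ = 0 ∧ w₁ = 0 ∧ w₂ = 0) ∨
      (u₁ = ![1, 0, 0, 0] ∧ u₂ = ![0, 1, 0, 0] ∧ w₁ = ![0, 0, 1, 0] ∧ w₂ = ![0, 0, 0, 1]) := by
  replace e₂ : u₂ - t • u₁ = bracket t u₁ w₂ := by
    rw [bracket_add_right, bracket_smul_right, ← e₁] at e₂
    rw [sub_eq_iff_eq_add, add_comm]; exact e₂
  replace e₃ : w₁ - w₂ = bracket t u₂ w₁ := by
    rw [bracket_add_right, ← e₄] at e₃
    rw [sub_eq_iff_eq_add]; exact e₃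
  have zero_of_u₁ : u₁ = 0 → u₁ = 0 ∧ u₂ = 0 ∧ w₁ = 0 ∧ w₂ = 0 := by
    intro h
    refine eq_zero_of_smul e₁ e₂ e₃ e₄ ⟨0, ?_⟩
    rw [zero_smul, sub_eq_iff_eq_add.1 e₂, h, ← zero_smul F (0 : Fin 4 → F), bracket_smul_left]
    simp
  have zero_of_parallel_u : (∃ s : F, u₁ = s • u₂) → u₁ = 0 ∧ u₂ = 0 ∧ w₁ = 0 ∧ w₂ = 0 := by
    intro h
    rcases exists_smul_symm h with h | h
    · exact zero_of_u₁ h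
    · exact eq_zero_of_smul e₁ e₂ e₃ e₄ h
  have zero_of_w₁ : w₁ = 0 → u₁ = 0 ∧ u₂ = 0 ∧ w₁ = 0 ∧ w₂ = 0 := by
    intro h
    apply zero_of_u₁
    rw [e₁, h, ← zero_smul F (0 : Fin 4 → F), bracket_smul_right]
    simp
  have zero_of_parallel_w : (∃ s : F, w₁ = s • w₂) → u₁ = 0 ∧ u₂ = 0 ∧ w₁ = 0 ∧ w₂ = 0 := by
    intro h
    rcases exists_smul_symm h with h | h
    · exact zero_of_w₁ h
    · exact eq_zero_of_smul_right e₁ e₂ e₃ e₄ h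
  -- Parallel pairs collapse to zero. What remains is the choice of a distinguished plane for each
  -- pair; equal planes give `bracket t u₁ w₁ = 0`, hence `u₁ = 0`.
  rcases bracket_eq_zero_cases e₅ with h | h | hu | hu
  · exact Or.inl (eq_zero_of_smul e₁ e₂ e₃ e₄ h)
  · exact Or.inl (zero_of_parallel_u h)
  all_goals rcases bracket_eq_zero_cases e₆ with h | h | hw | hw
  · exact Or.inl (eq_zero_of_smul_right e₁ e₂ e₃ e₄ h)
  · exact Or.inl (zero_of_parallel_w h)
  · left
    apply zero_of_u₁
    rw [e₁]
    apply vec4_ext <;> simp [bracket_zero, bracket_one, bracket_two, bracket_three, hu, hw]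
  -- The configuration of the standard basis.
  · obtain ⟨⟨hu2, hu3⟩, hu2', hu3'⟩ := hu
    obtain ⟨⟨hw0, hw1⟩, hw0', hw1'⟩ := hw
    have p0 := congrFun e₁ 0
    have p1 := congrFun e₁ 1
    have p2 := congrFun e₁ 2
    have p3 := congrFun e₁ 3
    have q0 := congrFun e₂ 0
    have q1 := congrFun e₂ 1
    have r0 := congrFun e₃ 0
    have r1 := congrFun e₃ 1
    have r2 := congrFun e₃ 2
    have r3 := congrFun e₃ 3
    have s0 := congrFun e₄ 0
    have s1 := congrFun e₄ 1
    have s2 := congrFun e₄ 2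
    have s3 := congrFun e₄ 3
    simp only [bracket_zero, bracket_one, bracket_two, bracket_three, Pi.sub_apply, Pi.smul_apply,
      smul_eq_mul, hu2, hu3, hu2', hu3', hw0, hw1, hw0', hw1', mul_zero, sub_zero]
      at p0 p1 p2 p3 q0 q1 r0 r1 r2 r3 s0 s1 s2 s3
    -- `p2` and `p3` give `u₁ 1 * w₁ 3 = 0`, and `p1` gives `u₁ 1 = u₁ 0 * w₁ 3`.
    have hf : u₁ 0 * w₁ 3 = 0 := by
      have : (u₁ 0 * w₁ 3) ^ 2 = 0 := by
        linear_combination (-u₁ 0 * w₁ 3) * p1 - u₁ 0 * p3 - u₁ 0 * p2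
      exact pow_eq_zero_iff two_ne_zero |>.1 this
    have hb : u₁ 1 = 0 := p1.trans hf
    have hc : u₂ 0 = 0 := by
      by_contra hc
      have hw3 : w₁ 3 = 0 := by grind
      have hw2 : w₁ 2 = 0 := by grind
      have := (zero_of_w₁ (vec4_ext hw0 hw1 hw2 hw3)).2.1
      exact hc (congrFun this 0)
    by_cases ha : u₁ 0 = 0
    · exact Or.inl (zero_of_u₁ (vec4_ext ha hb hu2 hu3))
    right
    have he : w₁ 2 = 1 := by grind
    have hf' : w₁ 3 = 0 := by grind
    have hhd : w₂ 3 = u₂ 1 := by grind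
    -- `r2` gives `w₂ 2 = 1 - u₂ 1` and `s2` gives `w₂ 2 * (1 - u₂ 1) = 0`, so the square vanishes.
    have hg : w₂ 2 = 0 := by grind
    have hd : u₂ 1 = 1 := by grind
    have ha' : u₁ 0 = 1 := by grind
    refine ⟨vec4_ext ha' hb hu2 hu3, vec4_ext hc hd hu2' hu3', vec4_ext hw0 hw1 he hf',
      vec4_ext hw0' hw1' hg (hhd.trans hd)⟩
  · exact Or.inl (eq_zero_of_smul_right e₁ e₂ e₃ e₄ h)
  · exact Or.inl (zero_of_parallel_w h)
  -- The planes are interchanged. If `u₁ ≠ 0`, the coordinates 0 and 1 of `e₁` and `e₂` put `w₁` and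
  -- `w₂` on one line, so they are parallel.
  · obtain ⟨⟨hu0, hu1⟩, hu0', hu1'⟩ := hu
    obtain ⟨⟨hw2, hw3⟩, hw2', hw3'⟩ := hw
    left
    have p0 := congrFun e₁ 0
    have p1 := congrFun e₁ 1
    have q0 := congrFun e₂ 0
    have q1 := congrFun e₂ 1
    simp only [bracket_zero, bracket_one, Pi.sub_apply, Pi.smul_apply,
      smul_eq_mul, hu0, hu0', hw2, hw3, hw2', hw3', mul_zero, sub_zero] at p0 p1 q0 q1
    by_cases h : u₁ 2 = 0 ∧ u₁ 3 = 0
    · exact zero_of_u₁ (vec4_ext hu0 hu1 h.1 h.2)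
    have he : w₁ 0 = 0 := by grind
    have hg : w₂ 0 = 0 := by grind
    by_cases hf : w₁ 1 = 0
    · exact zero_of_w₁ (vec4_ext he hf hw2 hw3)
    refine eq_zero_of_smul_right e₁ e₂ e₃ e₄ ⟨w₂ 1 / w₁ 1, vec4_ext ?_ ?_ ?_ ?_⟩ <;>
      simp [he, hg, hw2, hw3, hw2', hw3', hf]
  · left
    apply zero_of_u₁
    rw [e₁]
    apply vec4_ext <;> simp [bracket_zero, bracket_one, bracket_two, bracket_three, hu, hw]

end Core

/-! ### Rigidity for `p = 2` -/

/-- The squaring map for `p = 2`, `t = 0`. -/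
def squareMap (v : Fin 4 → ZMod 2) : Fin 4 → ZMod 2 :=
  ![v 0 - v 0 * v 2, v 1 - v 0 * v 3, v 2 - v 1 * v 2, v 3 - (v 1 * v 3 - v 1 * v 2)]

/-- Rigidity for `p = 2` with the images of three of the generators prescribed. -/
def RigidTwo (u₁ u₂ w₁ : Fin 4 → ZMod 2) : Prop :=
  ∀ w₂, squareMap u₂ = bracket 0 u₁ w₂ → squareMap w₁ = bracket 0 u₂ (w₁ + w₂) →
    squareMap w₂ = bracket 0 u₂ w₂ → bracket 0 w₁ w₂ = 0 →
      (u₁ = 0 ∧ u₂ = 0 ∧ w₁ = 0 ∧ w₂ = 0) ∨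
        (u₁ = ![1, 0, 0, 0] ∧ u₂ = ![0, 1, 0, 0] ∧ w₁ = ![0, 0, 1, 0] ∧ w₂ = ![0, 0, 0, 1])

instance (u₁ u₂ w₁ : Fin 4 → ZMod 2) : Decidable (RigidTwo u₁ u₂ w₁) :=
  Fintype.decidableForallFintype

/-- A finite check; each hypothesis stands as early as its variables allow, which prunes the search.
-/
theorem rigidTwo : ∀ u₁ u₂ : Fin 4 → ZMod 2, bracket 0 u₁ u₂ = 0 →
    ∀ w₁, squareMap u₁ = bracket 0 u₁ w₁ → RigidTwo u₁ u₂ w₁ := by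
  decide +kernel

/-! ### Reduction of the model modulo `p` -/

section Residue

variable {p t : ℕ}

/-- Reduction modulo `p`. -/
def red (p : ℕ) : ZMod (p ^ 2) →+* ZMod p :=
  ZMod.castHom (dvd_pow_self p two_ne_zero) (ZMod p)

theorem red_eq_zero_iff [NeZero p] (a : ZMod (p ^ 2)) : red p a = 0 ↔ p ∣ a.val := by
  rw [← ZMod.natCast_eq_zero_iff a.val p]
  conv_lhs => rw [← ZMod.natCast_rightInverse a]
  rw [map_natCast]

theorem mul_natCast_eq_zero_iff [NeZero p] (a : ZMod (p ^ 2)) :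
    (p : ZMod (p ^ 2)) * a = 0 ↔ red p a = 0 := by
  rw [red_eq_zero_iff]
  conv_lhs => rw [← ZMod.natCast_rightInverse a]
  rw [← Nat.cast_mul, ZMod.natCast_eq_zero_iff]
  generalize a.val = n
  rw [sq, Nat.mul_dvd_mul_iff_left (NeZero.pos p)]

theorem red_eq_of_mul_eq [NeZero p] {a b : ZMod (p ^ 2)}
    (h : (p : ZMod (p ^ 2)) * a = (p : ZMod (p ^ 2)) * b) : red p a = red p b := by
  rw [← sub_eq_zero, ← map_sub, ← mul_natCast_eq_zero_iff, mul_sub, h, sub_self]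

namespace Model

/-- The class of an element of the model modulo `p`. -/
def residue (v : Model p t) : Fin 4 → ZMod p :=
  ![red p v.x₁, red p v.x₂, red p v.y₁, red p v.y₂]

theorem residue_zero (v : Model p t) : residue v 0 = red p v.x₁ := rfl
theorem residue_one (v : Model p t) : residue v 1 = red p v.x₂ := rfl
theorem residue_two (v : Model p t) : residue v 2 = red p v.y₁ := rfl
theorem residue_three (v : Model p t) : residue v 3 = red p v.y₂ := rfl

theorem residue_mul (v w : Model p t) : residue (v * w) = residue v + residue w := by
  apply vec4_ext <;>
    simp [residue_zero, residue_one, residue_two, residue_three, mul_x₁, mul_x₂, mul_y₁, mul_y₂]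

/-- The reduction modulo `p` as a homomorphism. -/
def residueHom (p t : ℕ) : Model p t →* Multiplicative (Fin 4 → ZMod p) :=
  MonoidHom.mk' (fun v => Multiplicative.ofAdd (residue v)) fun v w => by
    rw [residue_mul, ofAdd_add]

theorem residue_pow (v : Model p t) (n : ℕ) : residue (v ^ n) = n • residue v :=
  congrArg Multiplicative.toAdd (map_pow (residueHom p t) v n)

/-- The `p`-th power map on residues. -/
def powerMap (p t : ℕ) (v : Fin 4 → ZMod p) : Fin 4 → ZMod p :=
  ![v 0 - p.choose 2 * (v 0 * v 2 - t * v 0 * v 3), v 1 - p.choose 2 * (v 0 * v 3),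
    v 2 - p.choose 2 * (v 1 * v 2), v 3 - p.choose 2 * (v 1 * v 3 - v 1 * v 2)]

/-- Both sides of `h` are `p` times a vector over `ZMod (p ^ 2)`; cancelling `p` leaves an equation
mod `p`. -/
theorem powerMap_eq_bracket [NeZero p] {u v w : Model p t} (h : u ^ p = ⁅v, w⁆) :
    powerMap p t (residue u) = bracket (t : ZMod p) (residue v) (residue w) := by
  rw [pow_eq, commutator_eq, Model.ext_iff] at h
  simp only [← mul_sub] at h
  obtain ⟨h0, h1, h2, h3⟩ := h
  replace h0 := red_eq_of_mul_eq h0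
  replace h1 := red_eq_of_mul_eq h1
  replace h2 := red_eq_of_mul_eq h2
  replace h3 := red_eq_of_mul_eq h3
  simp only [map_sub, map_mul, map_natCast] at h0 h1 h2 h3
  rw [mul_sub (red p u.x₂)] at h3
  exact vec4_ext h0 h1 h2 h3

theorem bracket_eq_zero [NeZero p] {v w : Model p t} (h : ⁅v, w⁆ = 1) :
    bracket (t : ZMod p) (residue v) (residue w) = 0 := by
  rw [commutator_eq, Model.ext_iff] at h
  simp only [one_x₁, one_x₂, one_y₁, one_y₂, mul_natCast_eq_zero_iff] at h
  simp only [map_sub, map_mul, map_natCast] at h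
  obtain ⟨h0, h1, h2, h3⟩ := h
  exact vec4_ext h0 h1 h2 h3

theorem powerMap_of_odd (hp : p.Prime) (h : p ≠ 2) (v : Fin 4 → ZMod p) :
    powerMap p t v = v := by
  have : (p.choose 2 : ZMod p) = 0 := by
    rw [ZMod.natCast_eq_zero_iff]
    exact hp.dvd_choose_self two_ne_zero (lt_of_le_of_ne hp.two_le h.symm)
  apply vec4_ext <;> simp [powerMap, this]

theorem powerMap_two (v : Fin 4 → ZMod 2) : powerMap 2 0 v = squareMap v := by
  apply vec4_ext <;> simp [powerMap, squareMap]

/-- The generators of the model. -/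
def basis (p t : ℕ) : Gen → Model p t
  | .a₁ => ⟨1, 0, 0, 0⟩
  | .a₂ => ⟨0, 1, 0, 0⟩
  | .b₁ => ⟨0, 0, 1, 0⟩
  | .b₂ => ⟨0, 0, 0, 1⟩

theorem basis_pow_mul (i j k l : ℕ) :
    basis p t .a₁ ^ i * basis p t .a₂ ^ j * basis p t .b₁ ^ k * basis p t .b₂ ^ l =
      ⟨i, j, k, l⟩ := by
  simp only [pow_eq]
  ext <;> simp [mul_x₁, mul_x₂, mul_y₁, mul_y₂, basis]

theorem central_of_residue_eq_zero [NeZero p] {v : Model p t} (h : residue v = 0)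
    (w : Model p t) : w * v = v * w := by
  have h0 := (mul_natCast_eq_zero_iff _).2 (congrFun h 0)
  have h1 := (mul_natCast_eq_zero_iff _).2 (congrFun h 1)
  have h2 := (mul_natCast_eq_zero_iff _).2 (congrFun h 2)
  have h3 := (mul_natCast_eq_zero_iff _).2 (congrFun h 3)
  ext <;> simp only [mul_x₁, mul_x₂, mul_y₁, mul_y₂] <;> grind

end Model

end Residue

/-! ### The presented group -/

namespace JKGroup

/-- The image of a generator in the presented group. -/
def of (p : ℕ) (l : ℕ × ℕ) (s : Gen) : JKGroup p l := PresentedGroup.of s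

theorem mk_eq_one {p : ℕ} {l : ℕ × ℕ} {r : FreeGroup Gen}
    (h : r ∈ classTwoRels ∪ powerRels p l) :
    PresentedGroup.mk (classTwoRels ∪ powerRels p l) r = 1 :=
  PresentedGroup.one_of_mem h

theorem classTwo {p : ℕ} {l : ℕ × ℕ} (x y z : JKGroup p l) : ⁅⁅x, y⁆, z⁆ = 1 := by
  obtain ⟨x, rfl⟩ := PresentedGroup.mk_surjective _ x
  obtain ⟨y, rfl⟩ := PresentedGroup.mk_surjective _ y
  obtain ⟨z, rfl⟩ := PresentedGroup.mk_surjective _ z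
  rw [← map_commutatorElement, ← map_commutatorElement]
  exact mk_eq_one (Or.inl ⟨x, y, z, rfl⟩)

variable (p t : ℕ)

theorem rel_a₁ : of p (t, 1) .a₁ ^ p = ⁅of p (t, 1) .a₁, of p (t, 1) .b₁⁆ := by
  have := mk_eq_one (p := p) (l := (t, 1)) (r := gen .a₁ ^ p * ⁅gen .a₁, gen .b₁⁆⁻¹)
    (Or.inr (by simp [powerRels]))
  rw [map_mul, map_inv, mul_inv_eq_one, map_pow, map_commutatorElement] at this
  exact this

theorem rel_a₂ : of p (t, 1) .a₂ ^ p =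
    ⁅of p (t, 1) .a₁, of p (t, 1) .b₁ ^ t * of p (t, 1) .b₂⁆ := by
  have := mk_eq_one (p := p) (l := (t, 1))
    (r := gen .a₂ ^ p * ⁅gen .a₁, gen .b₁ ^ t * gen .b₂ ^ 1⁆⁻¹) (Or.inr (by simp [powerRels]))
  rw [map_mul, map_inv, mul_inv_eq_one, map_pow, map_commutatorElement, map_mul, map_pow,
    pow_one] at this
  exact this

theorem rel_b₁ : of p (t, 1) .b₁ ^ p =
    ⁅of p (t, 1) .a₂, of p (t, 1) .b₁ * of p (t, 1) .b₂⁆ := by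
  have := mk_eq_one (p := p) (l := (t, 1))
    (r := gen .b₁ ^ p * ⁅gen .a₂, gen .b₁ * gen .b₂⁆⁻¹) (Or.inr (by simp [powerRels]))
  rw [map_mul, map_inv, mul_inv_eq_one, map_pow, map_commutatorElement, map_mul] at this
  exact this

theorem rel_b₂ : of p (t, 1) .b₂ ^ p = ⁅of p (t, 1) .a₂, of p (t, 1) .b₂⁆ := by
  have := mk_eq_one (p := p) (l := (t, 1)) (r := gen .b₂ ^ p * ⁅gen .a₂, gen .b₂⁆⁻¹)
    (Or.inr (by simp [powerRels]))
  rw [map_mul, map_inv, mul_inv_eq_one, map_pow, map_commutatorElement] at this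
  exact this

theorem rel_a₁_a₂ : ⁅of p (t, 1) .a₁, of p (t, 1) .a₂⁆ = 1 := by
  have := mk_eq_one (p := p) (l := (t, 1)) (r := ⁅gen .a₁, gen .a₂⁆)
    (Or.inr (by simp [powerRels]))
  rw [map_commutatorElement] at this
  exact this

theorem rel_b₁_b₂ : ⁅of p (t, 1) .b₁, of p (t, 1) .b₂⁆ = 1 := by
  have := mk_eq_one (p := p) (l := (t, 1)) (r := ⁅gen .b₁, gen .b₂⁆)
    (Or.inr (by simp [powerRels]))
  rw [map_commutatorElement] at this
  exact this

/-- The homomorphism from the presented group to the model. -/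
def toModel : JKGroup p (t, 1) →* Model p t :=
  PresentedGroup.toGroup (f := Model.basis p t) <| by
    have hsq := Model.natCast_sq_eq_zero p
    rintro r (⟨x, y, z, rfl⟩ | hr)
    · simp only [map_commutatorElement, Model.classTwo]
    · simp only [powerRels, Set.mem_insert_iff, Set.mem_singleton_iff] at hr
      rcases hr with rfl | rfl | rfl | rfl | rfl | rfl <;>
        simp only [map_mul, map_inv, map_pow, map_commutatorElement, mul_inv_eq_one, gen,
          FreeGroup.lift_apply_of, Model.pow_eq, Model.commutator_eq] <;>
        ext <;> simp [Model.basis, Model.mul_x₁, Model.mul_x₂, Model.mul_y₁, Model.mul_y₂,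
          Model.one_x₁, Model.one_x₂, Model.one_y₁, Model.one_y₂]

theorem toModel_of (s : Gen) : toModel p t (of p (t, 1) s) = Model.basis p t s :=
  PresentedGroup.toGroup.of _

/-- The element with given normal form. -/
def normalForm (v : Model p t) : JKGroup p (t, 1) :=
  of p (t, 1) .a₁ ^ v.x₁.val * of p (t, 1) .a₂ ^ v.x₂.val * of p (t, 1) .b₁ ^ v.y₁.val *
    of p (t, 1) .b₂ ^ v.y₂.val

theorem toModel_normalForm [NeZero p] (v : Model p t) : toModel p t (normalForm p t v) = v := by
  simp only [normalForm, map_mul, map_pow, toModel_of, Model.basis_pow_mul]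
  ext <;> exact ZMod.natCast_rightInverse _

/-- This and the next exchange rules solve the relations for the `⁅aᵢ, bⱼ⁆`, so that collection
produces only powers of generators. -/
theorem b₁_zpow_mul_a₁_zpow (n i : ℤ) : of p (t, 1) .b₁ ^ n * of p (t, 1) .a₁ ^ i =
    of p (t, 1) .a₁ ^ (i - p * (i * n)) * of p (t, 1) .b₁ ^ n := by
  rw [zpow_mul_zpow_eq classTwo, ← rel_a₁, ← zpow_natCast, ← zpow_mul, ← mul_assoc, ← zpow_add]
  congr 2; ring

theorem b₂_zpow_mul_a₂_zpow (n j : ℤ) : of p (t, 1) .b₂ ^ n * of p (t, 1) .a₂ ^ j =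
    of p (t, 1) .a₂ ^ j * of p (t, 1) .b₂ ^ (n - p * (j * n)) := by
  rw [zpow_mul_zpow_eq classTwo, ← commutator_zpow_left classTwo, commutator_commute classTwo,
    commutator_zpow_left classTwo, ← rel_b₂, ← zpow_natCast, ← zpow_mul, mul_assoc, ← zpow_add]
  congr 2; ring

theorem commute_a : Commute (of p (t, 1) .a₁) (of p (t, 1) .a₂) :=
  commutatorElement_eq_one_iff_mul_comm.1 (rel_a₁_a₂ p t)

theorem commute_b : Commute (of p (t, 1) .b₁) (of p (t, 1) .b₂) :=
  commutatorElement_eq_one_iff_mul_comm.1 (rel_b₁_b₂ p t)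

theorem b₁_zpow_mul_a₂_zpow (n j : ℤ) : of p (t, 1) .b₁ ^ n * of p (t, 1) .a₂ ^ j =
    of p (t, 1) .a₂ ^ j *
      (of p (t, 1) .b₁ ^ (n - p * (j * n)) * of p (t, 1) .b₂ ^ (p * (j * n))) := by
  have h : ⁅of p (t, 1) .a₂, of p (t, 1) .b₁⁆ =
      of p (t, 1) .b₁ ^ (p : ℤ) * of p (t, 1) .b₂ ^ (-(p : ℤ)) := by
    rw [zpow_neg, eq_mul_inv_iff_mul_eq, zpow_natCast, zpow_natCast, rel_b₁, rel_b₂,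
      commutator_mul_right classTwo]
  rw [zpow_mul_zpow_eq classTwo, ← commutator_zpow_left classTwo, commutator_commute classTwo,
    commutator_zpow_left classTwo, h, ((commute_b p t).zpow_zpow _ _).mul_zpow, ← zpow_mul,
    ← zpow_mul, mul_assoc, ← mul_assoc (_ ^ n), ← zpow_add]
  congr 3 <;> ring

theorem b₂_zpow_mul_a₁_zpow (n i : ℤ) : of p (t, 1) .b₂ ^ n * of p (t, 1) .a₁ ^ i =
    of p (t, 1) .a₁ ^ (i + p * t * (i * n)) * of p (t, 1) .a₂ ^ (-(p * (i * n))) *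
      of p (t, 1) .b₂ ^ n := by
  have h : ⁅of p (t, 1) .a₁, of p (t, 1) .b₂⁆ =
      of p (t, 1) .a₁ ^ (-(p * t : ℤ)) * of p (t, 1) .a₂ ^ (p : ℤ) := by
    rw [zpow_neg, eq_inv_mul_iff_mul_eq, zpow_mul, zpow_natCast, zpow_natCast, zpow_natCast,
      rel_a₂, commutator_mul_right classTwo, rel_a₁, ← zpow_natCast, ← zpow_natCast,
      commutator_zpow_right classTwo]
  rw [zpow_mul_zpow_eq classTwo, ← mul_assoc, ← commutator_zpow_left classTwo,
    commutator_commute classTwo,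
    commutator_zpow_left classTwo, h, ((commute_a p t).zpow_zpow _ _).mul_zpow, ← zpow_mul,
    ← zpow_mul, ← mul_assoc, ← zpow_add]
  congr 3 <;> ring

/-- The element with given integral exponents. -/
def word (i j k l : ℤ) : JKGroup p (t, 1) :=
  of p (t, 1) .a₁ ^ i * of p (t, 1) .a₂ ^ j * (of p (t, 1) .b₁ ^ k * of p (t, 1) .b₂ ^ l)

theorem zpow_mul_word (s : Gen) (n i j k l : ℤ) :
    ∃ i' j' k' l', of p (t, 1) s ^ n * word p t i j k l = word p t i' j' k' l' := by
  cases s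
  · refine ⟨n + i, j, k, l, ?_⟩
    simp only [word, zpow_add, mul_assoc]
  · refine ⟨i, n + j, k, l, ?_⟩
    simp only [word, zpow_add, ← mul_assoc]
    rw [((commute_a p t).zpow_zpow i n).eq]
  · refine ⟨i - p * (i * n), j, n - p * (j * n) + k, p * (j * n) + l, ?_⟩
    simp only [word]
    rw [← mul_assoc, ← mul_assoc (_ ^ n) (_ ^ i), b₁_zpow_mul_a₁_zpow, mul_assoc (_ ^ _) (_ ^ n),
      b₁_zpow_mul_a₂_zpow, zpow_add, zpow_add]
    simp only [mul_assoc]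
    rw [((commute_b p t).zpow_zpow k _).left_comm]
  · refine ⟨i + p * t * (i * n), -(p * (i * n)) + j, k, n - p * (j * n) + l, ?_⟩
    simp only [word]
    rw [← mul_assoc, ← mul_assoc (_ ^ n) (_ ^ i), b₂_zpow_mul_a₁_zpow, mul_assoc _ (_ ^ n),
      b₂_zpow_mul_a₂_zpow, zpow_add _ (-_) j, zpow_add _ (n - _) l]
    simp only [mul_assoc]
    rw [((commute_b p t).zpow_zpow k _).left_comm]

theorem exists_word (x : JKGroup p (t, 1)) : ∃ i j k l, x = word p t i j k l := by
  have key : ∀ (y : FreeGroup Gen) (i j k l : ℤ), ∃ i' j' k' l',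
      PresentedGroup.mk (classTwoRels ∪ powerRels p (t, 1)) y * word p t i j k l =
        word p t i' j' k' l' := by
    intro y
    induction y using FreeGroup.induction_on with
    | C1 => intro i j k l; exact ⟨i, j, k, l, by rw [map_one, one_mul]⟩
    | of s =>
      intro i j k l
      have := zpow_mul_word p t s 1 i j k l
      simp only [zpow_one] at this
      exact this
    | inv_of s _ =>
      intro i j k l
      have := zpow_mul_word p t s (-1) i j k l
      simp only [zpow_neg_one] at this
      exact this
    | mul y z hy hz =>
      intro i j k l
      obtain ⟨i', j', k', l', h⟩ := hz i j k l
      rw [map_mul, mul_assoc, h]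
      exact hy i' j' k' l'
  obtain ⟨y, rfl⟩ := PresentedGroup.mk_surjective _ x
  simpa [word] using key y 0 0 0 0

theorem of_pow_sq (s : Gen) : of p (t, 1) s ^ (p ^ 2) = 1 := by
  cases s
  · exact pow_sq_eq_one classTwo (rel_a₁ p t) (rel_a₁ p t)
  · exact pow_sq_eq_one classTwo (rel_a₁ p t) (rel_a₂ p t)
  · exact pow_sq_eq_one classTwo (rel_a₂ p t) (rel_b₁ p t)
  · exact pow_sq_eq_one classTwo (rel_a₂ p t) (rel_b₂ p t)

theorem of_zpow_eq_pow_val [NeZero p] (s : Gen) (i : ℤ) :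
    of p (t, 1) s ^ i = of p (t, 1) s ^ (i : ZMod (p ^ 2)).val := by
  rw [← zpow_natCast, ZMod.val_intCast]
  conv_lhs => rw [← Int.emod_add_mul_ediv i ((p ^ 2 : ℕ) : ℤ)]
  rw [zpow_add, zpow_mul _ ((p ^ 2 : ℕ) : ℤ), zpow_natCast _ (p ^ 2), of_pow_sq, one_zpow, mul_one]

/-- This bounds the order above by `p^8`; `toModel_normalForm` shows that distinct normal forms are
distinct elements. -/
theorem normalForm_surjective [NeZero p] : Function.Surjective (normalForm p t) := by
  intro x
  obtain ⟨i, j, k, l, rfl⟩ := exists_word p t x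
  refine ⟨⟨i, j, k, l⟩, ?_⟩
  simp only [normalForm, word, of_zpow_eq_pow_val, mul_assoc]

theorem normalForm_toModel [NeZero p] (x : JKGroup p (t, 1)) :
    normalForm p t (toModel p t x) = x := by
  obtain ⟨v, rfl⟩ := normalForm_surjective p t x
  rw [toModel_normalForm]

theorem toModel_injective [NeZero p] : Function.Injective (toModel p t) :=
  Function.LeftInverse.injective (g := normalForm p t) (normalForm_toModel p t)

/-- The underlying equivalence with quadruples of residues. -/
def equivProd [NeZero p] :
    JKGroup p (t, 1) ≃ ZMod (p ^ 2) × ZMod (p ^ 2) × ZMod (p ^ 2) × ZMod (p ^ 2) where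
  toFun x := ((toModel p t x).x₁, (toModel p t x).x₂, (toModel p t x).y₁, (toModel p t x).y₂)
  invFun q := normalForm p t ⟨q.1, q.2.1, q.2.2.1, q.2.2.2⟩
  left_inv := normalForm_toModel p t
  right_inv q := by simp only [toModel_normalForm]

theorem natCard_eq [NeZero p] : Nat.card (JKGroup p (t, 1)) = p ^ 8 := by
  rw [Nat.card_congr (equivProd p t)]
  simp only [Nat.card_prod, Nat.card_zmod]
  ring

/-! ### The subgroup `N`, central and contained in the derived subgroup -/

/-- The kernel of reduction modulo `p`. -/
def frattiniKer : Subgroup (JKGroup p (t, 1)) :=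
  ((Model.residueHom p t).comp (toModel p t)).ker

theorem mem_frattiniKer {x : JKGroup p (t, 1)} :
    x ∈ frattiniKer p t ↔ Model.residue (toModel p t x) = 0 := Iff.rfl

theorem frattiniKer_le_center [NeZero p] :
    frattiniKer p t ≤ Subgroup.center (JKGroup p (t, 1)) := by
  intro x hx
  rw [Subgroup.mem_center_iff]
  intro y
  apply toModel_injective p t
  rw [map_mul, map_mul, Model.central_of_residue_eq_zero hx]

theorem of_pow_mem_commutator (s : Gen) {n : ℕ} (h : p ∣ n) :
    of p (t, 1) s ^ n ∈ commutator (JKGroup p (t, 1)) := by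
  obtain ⟨m, rfl⟩ := h
  rw [pow_mul]
  refine pow_mem ?_ m
  have key (x y : JKGroup p (t, 1)) : ⁅x, y⁆ ∈ commutator (JKGroup p (t, 1)) :=
    Subgroup.commutator_mem_commutator (Subgroup.mem_top x) (Subgroup.mem_top y)
  cases s
  · rw [rel_a₁]; exact key _ _
  · rw [rel_a₂]; exact key _ _
  · rw [rel_b₁]; exact key _ _
  · rw [rel_b₂]; exact key _ _

/-- All exponents in the normal form are divisible by `p`, and the `p`-th power of each generator is
a commutator. -/
theorem frattiniKer_le_commutator [NeZero p] :
    frattiniKer p t ≤ commutator (JKGroup p (t, 1)) := by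
  intro x hx
  rw [mem_frattiniKer] at hx
  rw [← normalForm_toModel p t x]
  refine mul_mem (mul_mem (mul_mem ?_ ?_) ?_) ?_ <;>
    refine of_pow_mem_commutator p t _ ((red_eq_zero_iff _).1 ?_)
  · exact congrFun hx 0
  · exact congrFun hx 1
  · exact congrFun hx 2
  · exact congrFun hx 3

/-! ### Endomorphisms of the presented group -/

variable {p t}

/-- The images of the generators under an endomorphism vanish modulo `p`, or agree with the
generators modulo `p`. -/
theorem residue_dichotomy (hp : p.Prime) (h : p ≠ 2 ∨ (p = 2 ∧ t = 0))
    (θ : JKGroup p (t, 1) →* Model p t) :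
    (∀ s, Model.residue (θ (of p (t, 1) s)) = 0) ∨
      ∀ s, Model.residue (θ (of p (t, 1) s)) = Model.residue (Model.basis p t s) := by
  have : NeZero p := ⟨hp.ne_zero⟩
  have : Fact p.Prime := ⟨hp⟩
  have e₁ := congrArg θ (rel_a₁ p t)
  have e₂ := congrArg θ (rel_a₂ p t)
  have e₃ := congrArg θ (rel_b₁ p t)
  have e₄ := congrArg θ (rel_b₂ p t)
  have e₅ := congrArg θ (rel_a₁_a₂ p t)
  have e₆ := congrArg θ (rel_b₁_b₂ p t)
  simp only [map_pow, map_commutatorElement, map_mul, map_one] at e₁ e₂ e₃ e₄ e₅ e₆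
  replace e₁ := Model.powerMap_eq_bracket e₁
  replace e₂ := Model.powerMap_eq_bracket e₂
  replace e₃ := Model.powerMap_eq_bracket e₃
  replace e₄ := Model.powerMap_eq_bracket e₄
  replace e₅ := Model.bracket_eq_zero e₅
  replace e₆ := Model.bracket_eq_zero e₆
  rw [Model.residue_mul] at e₂ e₃
  rw [Model.residue_pow] at e₂
  have key : (Model.residue (θ (of p (t, 1) .a₁)) = 0 ∧ Model.residue (θ (of p (t, 1) .a₂)) = 0 ∧
      Model.residue (θ (of p (t, 1) .b₁)) = 0 ∧ Model.residue (θ (of p (t, 1) .b₂)) = 0) ∨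
      (Model.residue (θ (of p (t, 1) .a₁)) = ![1, 0, 0, 0] ∧
        Model.residue (θ (of p (t, 1) .a₂)) = ![0, 1, 0, 0] ∧
        Model.residue (θ (of p (t, 1) .b₁)) = ![0, 0, 1, 0] ∧
        Model.residue (θ (of p (t, 1) .b₂)) = ![0, 0, 0, 1]) := by
    rcases h with h | ⟨rfl, rfl⟩
    · simp only [Model.powerMap_of_odd hp h] at e₁ e₂ e₃ e₄
      rw [← Nat.cast_smul_eq_nsmul (ZMod p)] at e₂
      exact rigid_of_linear e₁ e₂ e₃ e₄ e₅ e₆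
    · simp only [Model.powerMap_two, Nat.cast_zero, zero_smul, zero_add] at e₁ e₂ e₃ e₄ e₅ e₆
      exact rigidTwo _ _ e₅ _ e₁ _ e₂ e₃ e₄ e₆
  rcases key with ⟨h₁, h₂, h₃, h₄⟩ | ⟨h₁, h₂, h₃, h₄⟩
  · left
    rintro (_ | _ | _ | _) <;> assumption
  · right
    rintro (_ | _ | _ | _)
    · rw [h₁]; apply vec4_ext <;> simp [Model.residue, Model.basis]
    · rw [h₂]; apply vec4_ext <;> simp [Model.residue, Model.basis]
    · rw [h₃]; apply vec4_ext <;> simp [Model.residue, Model.basis]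
    · rw [h₄]; apply vec4_ext <;> simp [Model.residue, Model.basis]

theorem endomorphism_dichotomy (hp : p.Prime) (h : p ≠ 2 ∨ (p = 2 ∧ t = 0))
    (φ : JKGroup p (t, 1) →* JKGroup p (t, 1)) :
    (∀ x, φ x ∈ frattiniKer p t) ∨ ∀ x, φ x * x⁻¹ ∈ frattiniKer p t := by
  set ρ : JKGroup p (t, 1) →* Multiplicative (Fin 4 → ZMod p) :=
    (Model.residueHom p t).comp (toModel p t)
  rcases residue_dichotomy hp h ((toModel p t).comp φ) with h' | h'
  · left
    have : ρ.comp φ = 1 := PresentedGroup.ext h'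
    exact fun x => DFunLike.congr_fun this x
  · right
    have : ρ.comp φ = ρ := PresentedGroup.ext fun s => by
      change Multiplicative.ofAdd (Model.residue (toModel p t (φ (of p (t, 1) s)))) =
        Multiplicative.ofAdd (Model.residue (toModel p t (of p (t, 1) s)))
      rw [toModel_of]
      exact congrArg _ (h' s)
    intro x
    change ρ (φ x * x⁻¹) = 1
    rw [map_mul, map_inv, mul_inv_eq_one]
    exact DFunLike.congr_fun this x

theorem endCommutative (hp : p.Prime) (h : p ≠ 2 ∨ (p = 2 ∧ t = 0)) :
    EndCommutative (JKGroup p (t, 1)) := by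
  have : NeZero p := ⟨hp.ne_zero⟩
  exact endCommutative_of_dichotomy (frattiniKer p t) (frattiniKer_le_center p t)
    (frattiniKer_le_commutator p t) (endomorphism_dichotomy hp h)

theorem finite (hp : p.Prime) : Finite (JKGroup p (t, 1)) := by
  have : NeZero p := ⟨hp.ne_zero⟩
  exact Nat.finite_of_card_ne_zero (by rw [natCard_eq]; exact pow_ne_zero _ hp.ne_zero)

theorem range_le_center (hp : p.Prime) (h : p ≠ 2 ∨ (p = 2 ∧ t = 0))
    (φ : JKGroup p (t, 1) →* JKGroup p (t, 1)) (hφ : ¬ Function.Bijective φ) :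
    φ.range ≤ Subgroup.center (JKGroup p (t, 1)) := by
  have : NeZero p := ⟨hp.ne_zero⟩
  have := finite (t := t) hp
  rcases endomorphism_dichotomy hp h φ with h' | h'
  · rintro _ ⟨x, rfl⟩
    exact frattiniKer_le_center p t (h' x)
  · exact absurd (Finite.injective_iff_bijective.1 (injective_of_identity_mod
      (frattiniKer_le_center p t) (frattiniKer_le_commutator p t) h')) hφ

theorem exists_not_commute (hp : p.Prime) : ∃ x y : JKGroup p (t, 1), x * y ≠ y * x := by
  have : NeZero p := ⟨hp.ne_zero⟩
  have : Fact p.Prime := ⟨hp⟩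
  refine ⟨of p (t, 1) .a₁, of p (t, 1) .b₁, fun h => ?_⟩
  rw [← commutatorElement_eq_one_iff_mul_comm] at h
  have h1 := congrArg (toModel p t) h
  rw [map_commutatorElement, toModel_of, toModel_of, map_one] at h1
  have h2 := congrFun (Model.bracket_eq_zero h1) 0
  simp [bracket, Model.residue, Model.basis] at h2

end JKGroup

end JonahKonvisser

theorem theorem3p2 :
    (∀ (p : ℕ) (l : ℕ × ℕ), p.Prime → l ∈ JonahKonvisser.params p →
      ((3 ≤ p ∧ l ≠ (1, 0)) ∨ (p = 2 ∧ l = (0, 1))) →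
        Nat.card (JonahKonvisser.JKGroup p l) = p ^ 8 ∧
        (∀ φ : JonahKonvisser.JKGroup p l →* JonahKonvisser.JKGroup p l,
          ¬ Function.Bijective φ →
            φ.range ≤ Subgroup.center (JonahKonvisser.JKGroup p l)) ∧
        JonahKonvisser.EndCommutative (JonahKonvisser.JKGroup p l)) ∧
    (∀ p : ℕ, p.Prime → ∃ (G : Type) (_ : Group G),
      Finite G ∧ IsPGroup p G ∧ (∃ x y : G, x * y ≠ y * x) ∧
        JonahKonvisser.EndCommutative G) := by
  constructor
  · rintro p ⟨t, m⟩ hp hl h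
    have : NeZero p := ⟨hp.ne_zero⟩
    obtain ⟨rfl, h'⟩ : m = 1 ∧ (p ≠ 2 ∨ (p = 2 ∧ t = 0)) := by
      rcases h with ⟨h3, hne⟩ | ⟨h2, h01⟩
      · rcases hl with hl | hl
        · exact absurd hl hne
        · exact ⟨hl.2, Or.inl (by omega)⟩
      · rw [Prod.mk.injEq] at h01
        exact ⟨h01.2, Or.inr ⟨h2, h01.1⟩⟩
    exact ⟨JonahKonvisser.JKGroup.natCard_eq p t, JonahKonvisser.JKGroup.range_le_center hp h',
      JonahKonvisser.JKGroup.endCommutative hp h'⟩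
  · intro p hp
    have : NeZero p := ⟨hp.ne_zero⟩
    -- The parameter `(0, 1)` is admissible for every prime, including 2.
    exact ⟨JonahKonvisser.JKGroup p (0, 1), inferInstance, JonahKonvisser.JKGroup.finite hp,
      IsPGroup.of_card (JonahKonvisser.JKGroup.natCard_eq p 0),
      JonahKonvisser.JKGroup.exists_not_commute hp,
      JonahKonvisser.JKGroup.endCommutative hp (by tauto)⟩
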